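/- Let $\mathbb F$ be a field and let $\mathcal M$ be a $\Sigma$-module over $\mathbb F$, i.e. a sequence $(\mathcal M(n))_{n\ge 0}$ where $\mathcal M(n)$ is an $\mathbb F$-linear representation of the symmetric group $\Sigma_n$ (no reducedness is assumed). **Notation.** For $p,n\ge 0$ let $\operatorname{Comp}_p(n)$ be the set of $p$-tuples $\underline r=(r_1,\dots,r_p)$ of non-negative integers with sum $n$. Such an $\underline r$ cuts $\{1,\dots,n\}$ into consecutive blocks $\underline r_1,\dots,\underline r_p$ of sizes $r_1,\dots,r_p$; let $\Sigma_{\underline r}=\prod_i\Sigma_{\underline r_i}\subseteq\Sigma_n$ be the subgroup preserving each block. For $\rho\in\Sigma_p$ put $\underline r^{\rho}=(r_{\rho^{-1}(1)},\dots,r_{\rho^{-1}(p)})$ and let $\rho^*\in\Sigma_n$ be the permutation that maps the $i$-th block of $\underline r$ onto the $\rho(i)$-th block of $\underline r^\rho$ in an order-preserving way. For $\underline q\in\operatorname{Comp}_s(p)$ put $\underline q\rhd\underline r=\big(\sum_{j\in\underline q_1}r_j,\dots,\sum_{j\in\underline q_s}r_j\big)\in\operatorname{Comp}_s(n)$. For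 $l+m=r_1$ put $\underline r\circ_1(l,m)=(l,m,r_2,\dots,r_p)$. The group $\Sigma_n$ acts on $A^{\otimes n}$ by $\sigma\cdot(a_1\otimes\cdots\otimes a_n)=a_{\sigma^{-1}(1)}\otimes\cdots\otimes a_{\sigma^{-1}(n)}$ and diagonally on $\mathcal M(n)\otimes A^{\otimes n}$. **The category $\Gamma(\mathcal M)_{mod}$.** For an $\mathbb F$-vector space $A$ let $\Gamma(\mathcal M,A)=\bigoplus_{n\ge0}(\mathcal M(n)\otimes A^{\otimes n})^{\Sigma_n}$, which is functorial in $A$. The objects of $\Gamma(\mathcal M)_{mod}$ are the pairs $(A,f)$ of an $\mathbb F$-vector space $A$ and a linear map $f:\Gamma(\mathcal M,A)\to A$; a morphism $(A,f)\to(A',f')$ is a linear map $g:A\to A'$ with $f'\circ\Gamma(\mathcal M,g)=g\circ f$. **The category $\beta(\mathcal M)$.** Its objects are the pairs $(A,\beta)$ of an $\mathbb F$-vector space $A$ and a family of maps $\beta_{x,\underline r}:A^{\times p}\to A$, one for all $p,n\ge0$, $\underline r\in\operatorname{Comp}_p(n)$ and $x\in\mathcal M(n)^{\Sigma_{\underline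 r}}$, such that: * ($\beta$1) $\beta_{x,\underline r}((a_i)_i)=\beta_{\rho^*\cdot x,\underline r^\rho}((a_{\rho^{-1}(i)})_i)$ for all $\rho\in\Sigma_p$; * ($\beta$2) $\beta_{x,(0,r_1,\dots,r_p)}(a_0,a_1,\dots,a_p)=\beta_{x,(r_1,\dots,r_p)}(a_1,\dots,a_p)$; * ($\beta$3) $\beta_{x,\underline r}(\lambda a_1,a_2,\dots,a_p)=\lambda^{r_1}\beta_{x,\underline r}(a_1,\dots,a_p)$ for all $\lambda\in\mathbb F$ and $p\ge1$; * ($\beta$4) for $\underline q\in\operatorname{Comp}_s(p)$, $\ \beta_{x,\underline r}(\underbrace{a_1,\dots,a_1}_{q_1},\dots,\underbrace{a_s,\dots,a_s}_{q_s})=\beta_{\sum_{\sigma\in\Sigma_{\underline q\rhd\underline r}/\Sigma_{\underline r}}\sigma\cdot x,\ \underline q\rhd\underline r}(a_1,\dots,a_s)$; * ($\beta$5) $\beta_{x,\underline r}(a_0+a_1,a_2,\dots,a_p)=\sum_{l+m=r_1}\beta_{x,\underline r\circ_1(l,m)}(a_0,a_1,a_2,\dots,a_p)$ for $p\ge1$;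 * ($\beta$6) $\beta_{\lambda x+y,\underline r}=\lambda\beta_{x,\underline r}+\beta_{y,\underline r}$ for all $\lambda\in\mathbb F$ and $x,y\in\mathcal M(n)^{\Sigma_{\underline r}}$. The morphisms are the linear maps compatible with all the operations $\beta_{x,\underline r}$. **The functor $F_{\mathcal M}$.** It sends $(A,f)$ to $(A,\beta)$ with $$\beta_{x,\underline r}(a_1,\dots,a_p)=f\Big(\sum_{\sigma\in\Sigma_n/\Sigma_{\underline r}}\sigma\cdot x\otimes\sigma\cdot\big(a_1^{\otimes r_1}\otimes\cdots\otimes a_p^{\otimes r_p}\big)\Big)$$ and is the identity on underlying linear maps; it is a well-defined functor $\Gamma(\mathcal M)_{mod}\to\beta(\mathcal M)$. **Proposition.** For every $\Sigma$-module $\mathcal M$, the functor $F_{\mathcal M}:\Gamma(\mathcal M)_{mod}\to\beta(\mathcal M)$ is an isomorphism of categories. -/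

import Mathlib

open scoped TensorProduct DirectSum
open CategoryTheory

universe u v w

noncomputable section

namespace DividedPower

/-! ### Compositions of integers, blocks and Young subgroups -/

/-- `Comp p n`: the `p`-tuples of non-negative integers with sum `n`. -/
structure Comp (p n : ℕ) where
  /-- the parts -/
  parts : Fin p → ℕ
  sum_parts : ∑ i, parts i = n

namespace Comp

variable {p s n : ℕ}

/-- The lexicographic identification of pairs (block `i`, position in the block `i`) with
`Fin n`; it lists the blocks of consecutive integers of lengths `r₁, …, r_p` one after the other. -/
def blockEquiv (r : Comp p n) : (Σ i : Fin p, Fin (r.parts i)) ≃ Fin n :=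
  finSigmaFinEquiv.trans (finCongr r.sum_parts)

/-- The function `Fin n → Fin p` sending an element to the index of the block that contains it. -/
def block (r : Comp p n) (j : Fin n) : Fin p := (r.blockEquiv.symm j).1

/-- The Young subgroup of `r`: the permutations that preserve every block of `r`. -/
def young (r : Comp p n) : Subgroup (Equiv.Perm (Fin n)) where
  carrier := {σ | ∀ j, r.block (σ j) = r.block j}
  one_mem' := fun _ => rfl
  mul_mem' := fun {σ τ} hσ hτ j => (hσ (τ j)).trans (hτ j)
  inv_mem' := fun {σ} hσ j => by
    have h := hσ (σ⁻¹ j)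
    rw [show σ (σ⁻¹ j) = j from σ.apply_symm_apply j] at h
    exact h.symm

/-- The permuted composition `r^ρ = (r_{ρ⁻¹(1)}, …, r_{ρ⁻¹(p)})`. -/
def perm (r : Comp p n) (ρ : Equiv.Perm (Fin p)) : Comp p n :=
  ⟨fun i => r.parts (ρ⁻¹ i), (Equiv.sum_comp ρ⁻¹ r.parts).trans r.sum_parts⟩

/-- The block permutation `ρ^*`: it sends the `i`-th block of `r` onto the `ρ(i)`-th block
of `r^ρ`, preserving the order inside the block. -/
def blockPerm (r : Comp p n) (ρ : Equiv.Perm (Fin p)) : Equiv.Perm (Fin n) :=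
  (r.blockEquiv.symm.trans (Equiv.sigmaCongr ρ fun i =>
    finCongr (congrArg r.parts (ρ.symm_apply_apply i).symm))).trans (r.perm ρ).blockEquiv

/-- The composition `(0, r₁, …, r_p)`. -/
def zeroCons (r : Comp p n) : Comp (p + 1) n :=
  ⟨Fin.cons 0 r.parts, by rw [Fin.sum_cons, r.sum_parts, zero_add]⟩

/-- The composition `r ∘₁ (l, m) = (l, m, r₂, …, r_p)`, for `l + m = r₁`. -/
def splitFirst (r : Comp (p + 1) n) (lm : Finset.HasAntidiagonal.antidiagonal (r.parts 0)) : Comp (p + 2) n :=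
  ⟨Fin.cons lm.1.1 (Fin.cons lm.1.2 (Fin.tail r.parts)), by
    rw [Fin.sum_cons, Fin.sum_cons, ← add_assoc, Finset.HasAntidiagonal.mem_antidiagonal.1 lm.2]
    exact (Fin.sum_univ_succ r.parts).symm.trans r.sum_parts⟩

/-- The composition `q ▷ r`, whose `i`-th part is the sum of the `r_j` over the
elements `j` of the `i`-th block of `q`. -/
def merge (q : Comp s p) (r : Comp p n) : Comp s n :=
  ⟨fun i => ∑ j with q.block j = i, r.parts j, (Finset.sum_fiberwise _ _ _).trans r.sum_parts⟩

/-! Basic facts on blocks. -/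

lemma block_blockEquiv (r : Comp p n) (y : Σ i : Fin p, Fin (r.parts i)) :
    r.block (r.blockEquiv y) = y.1 := by
  simp [block]

lemma blockEquiv_val (r : Comp p n) (y : Σ i : Fin p, Fin (r.parts i)) :
    (r.blockEquiv y : ℕ) = (∑ k with k < y.1, r.parts k) + y.2 := by
  have h : (r.blockEquiv y : ℕ) = ∑ i : Fin y.1, r.parts (Fin.castLE y.1.2.le i) + y.2 := by
    simp [blockEquiv]
  rw [h]
  congr 1
  refine Finset.sum_nbij (fun i => Fin.castLE y.1.2.le i) ?_ ?_ ?_ ?_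
  · intro i _
    simp only [Finset.mem_filter, Finset.mem_univ, true_and]
    exact i.2
  · intro i _ j _ hij
    simpa [Fin.ext_iff] using hij
  · intro k hk
    have hk' : k < y.1 := by simpa using hk
    exact ⟨⟨k, hk'⟩, by simp, by simp⟩
  · intro i _
    rfl

lemma block_monotone (r : Comp p n) : Monotone r.block := by
  intro j j' h
  obtain ⟨y, rfl⟩ := r.blockEquiv.surjective j
  obtain ⟨y', rfl⟩ := r.blockEquiv.surjective j'
  rw [block_blockEquiv, block_blockEquiv]
  by_contra! hlt
  rw [Fin.le_def, blockEquiv_val, blockEquiv_val] at h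
  have h1 : (∑ k with k < y'.1, r.parts k) + r.parts y'.1 ≤ ∑ k with k < y.1, r.parts k := by
    rw [add_comm, ← Finset.sum_insert (by simp)]
    refine Finset.sum_le_sum_of_subset ?_
    intro k hk
    simp only [Finset.mem_insert, Finset.mem_filter, Finset.mem_univ, true_and] at hk ⊢
    rcases hk with rfl | hk
    · exact hlt
    · exact hk.trans hlt
  have := y'.2.2
  omega

lemma card_block (r : Comp p n) (i : Fin p) :
    (Finset.univ.filter fun j => r.block j = i).card = r.parts i := by
  rw [← Fintype.card_fin (r.parts i), ← Finset.card_univ]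
  symm
  refine Finset.card_nbij (fun k => r.blockEquiv ⟨i, k⟩) ?_ ?_ ?_
  · intro k _
    simp [block_blockEquiv]
  · intro k _ k' _ h
    have := r.blockEquiv.injective h
    simpa using this
  · intro j hj
    obtain ⟨⟨i', k⟩, rfl⟩ := r.blockEquiv.surjective j
    simp only [Finset.coe_filter, Finset.mem_univ, true_and, Set.mem_ofPred_eq,
      block_blockEquiv] at hj
    subst hj
    exact ⟨k, by simp, rfl⟩

/-- A monotone function whose fibres have the sizes prescribed by `r` is the block function. -/
lemma eq_block (r : Comp p n) (d : Fin n → Fin p) (hd : Monotone d)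
    (hc : ∀ i, (Finset.univ.filter fun j => d j = i).card = r.parts i) : d = r.block := by
  have key : ∀ i : Fin p, ∀ j, d j < i ↔ r.block j < i := by
    intro i
    have hcard : ∀ e : Fin n → Fin p,
        (Finset.univ.filter fun j => e j < i).card =
          ∑ k with k < i, (Finset.univ.filter fun j => e j = k).card := by
      intro e
      rw [Finset.card_eq_sum_card_fiberwise (f := e) (t := Finset.univ.filter fun k => k < i)
        (by intro j hj; simpa using hj)]
      refine Finset.sum_congr rfl fun k hk => ?_
      congr 1
      ext j
      simp only [Finset.mem_filter, Finset.mem_univ, true_and] at hk ⊢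
      constructor
      · exact fun h => h.2
      · rintro rfl
        exact ⟨hk, rfl⟩
    have hEq : (Finset.univ.filter fun j => d j < i).card =
        (Finset.univ.filter fun j => r.block j < i).card := by
      rw [hcard, hcard]
      exact Finset.sum_congr rfl fun k _ => (hc k).trans (r.card_block k).symm
    have hset : (Finset.univ.filter fun j => d j < i) =
        (Finset.univ.filter fun j => r.block j < i) := by
      by_cases hsub : (Finset.univ.filter fun j => d j < i) ⊆
          (Finset.univ.filter fun j => r.block j < i)
      · exact Finset.eq_of_subset_of_card_le hsub hEq.ge
      · symm
        refine Finset.eq_of_subset_of_card_le ?_ hEq.le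
        obtain ⟨j, hj, hj'⟩ := Finset.not_subset.1 hsub
        intro k hk
        simp only [Finset.mem_filter, Finset.mem_univ, true_and, not_lt] at hj hj' hk ⊢
        have hkj : k ≤ j := by
          by_contra! hlt
          exact absurd (hj'.trans (r.block_monotone hlt.le)) (not_le.2 hk)
        exact (hd hkj).trans_lt hj
    intro j
    have := Finset.ext_iff.1 hset j
    simpa using this
  funext j
  refine le_antisymm ?_ ?_
  · by_contra! h
    exact lt_irrefl _ ((key _ _).2 h)
  · by_contra! h
    exact lt_irrefl _ ((key _ _).1 h)

lemma block_zeroCons (r : Comp p n) (j : Fin n) : r.zeroCons.block j = (r.block j).succ := by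
  refine (congrFun (eq_block r.zeroCons (fun j => (r.block j).succ) ?_ ?_) j).symm
  · exact fun a b h => Fin.succ_le_succ_iff.2 (r.block_monotone h)
  · intro i
    refine Fin.cases ?_ (fun i => ?_) i
    · simp [zeroCons, Fin.succ_ne_zero]
    · simp [zeroCons, card_block]

lemma block_merge (q : Comp s p) (r : Comp p n) (j : Fin n) :
    (q.merge r).block j = q.block (r.block j) := by
  refine (congrFun (eq_block (q.merge r) (fun j => q.block (r.block j)) ?_ ?_) j).symm
  · exact q.block_monotone.comp r.block_monotone
  · intro i
    rw [Finset.card_eq_sum_card_fiberwise (f := r.block)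
      (t := Finset.univ.filter fun k => q.block k = i) (by intro j hj; simpa using hj)]
    refine Finset.sum_congr rfl fun k hk => ?_
    rw [← r.card_block k]
    congr 1
    ext j
    simp only [Finset.mem_filter, Finset.mem_univ, true_and] at hk ⊢
    constructor
    · exact fun h => h.2
    · rintro rfl
      exact ⟨hk, rfl⟩

lemma block_splitFirst (r : Comp (p + 1) n) (lm : Finset.HasAntidiagonal.antidiagonal (r.parts 0)) (j : Fin n) :
    Fin.predAbove 0 ((r.splitFirst lm).block j) = r.block j := by
  refine congrFun (eq_block r (fun j => Fin.predAbove 0 ((r.splitFirst lm).block j)) ?_ ?_) j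
  · exact (Fin.predAbove_right_monotone 0).comp (block_monotone _)
  · intro i
    refine Fin.cases ?_ (fun i => ?_) i
    · have h0 := (r.splitFirst lm).card_block 0
      have h1 := (r.splitFirst lm).card_block 1
      have hsum : (r.splitFirst lm).parts 0 + (r.splitFirst lm).parts 1 = r.parts 0 :=
        Finset.HasAntidiagonal.mem_antidiagonal.1 lm.2
      rw [← hsum, ← h0, ← h1, ← Finset.card_union_of_disjoint]
      · congr 1
        ext j
        simp only [Finset.mem_filter, Finset.mem_univ, true_and, Finset.mem_union]
        generalize (r.splitFirst lm).block j = k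
        refine Fin.cases ?_ (fun k => ?_) k
        · simp
        · rw [← Fin.succ_zero_eq_one, Fin.succ_inj]
          simp
      · rw [Finset.disjoint_left]
        intro j hj hj'
        simp only [Finset.mem_filter, Finset.mem_univ, true_and] at hj hj'
        rw [hj] at hj'
        simp at hj'
    · have h := (r.splitFirst lm).card_block i.succ.succ
      have h' : (r.splitFirst lm).parts i.succ.succ = r.parts i.succ := rfl
      rw [← h', ← h]
      congr 1
      ext j
      simp only [Finset.mem_filter, Finset.mem_univ, true_and]
      generalize (r.splitFirst lm).block j = k
      refine Fin.cases ?_ (fun k => ?_) k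
      · simp [Fin.ext_iff]
      · simp

lemma block_blockPerm (r : Comp p n) (ρ : Equiv.Perm (Fin p)) (j : Fin n) :
    (r.perm ρ).block (r.blockPerm ρ j) = ρ (r.block j) := by
  simp only [blockPerm, block, Equiv.trans_apply, Equiv.symm_apply_apply]
  rfl

lemma young_zeroCons (r : Comp p n) : r.zeroCons.young = r.young := by
  ext σ
  change (∀ j, _ = _) ↔ (∀ j, _ = _)
  simp [block_zeroCons]

lemma young_le_merge (q : Comp s p) (r : Comp p n) : r.young ≤ (q.merge r).young := by
  intro σ hσ j
  rw [block_merge, block_merge, hσ j]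

lemma young_splitFirst_le (r : Comp (p + 1) n) (lm : Finset.HasAntidiagonal.antidiagonal (r.parts 0)) :
    (r.splitFirst lm).young ≤ r.young := by
  intro σ hσ j
  rw [← r.block_splitFirst lm, ← r.block_splitFirst lm, hσ j]

end Comp

/-! ### Sums over cosets -/

section CosetSum

variable {F : Type*} [CommRing F] {G : Type*} [Group G] {V : Type*} [AddCommGroup V]
  [Module F V]

/-- For a vector `v` fixed by the subgroup `H`, this is the sum `∑_{σ ∈ G/H} σ · v`; each coset
contributes the value on a representative, which does not depend on the representative. -/
def cosetSum [Finite G] (ρ : Representation F G V) (H : Subgroup G) (v : V) : V :=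
  letI := Fintype.ofFinite (G ⧸ H)
  ∑ c : G ⧸ H, ρ c.out v

variable (ρ : Representation F G V) (H : Subgroup G)

lemma apply_out {v : V} (hv : ∀ h ∈ H, ρ h v = v) (g : G) :
    ρ (QuotientGroup.mk g : G ⧸ H).out v = ρ g v := by
  obtain ⟨h, hh⟩ := QuotientGroup.mk_out_eq_mul H g
  rw [hh, map_mul, Module.End.mul_apply, hv h h.2]

lemma cosetSum_fixed [Finite G] {v : V} (hv : ∀ h ∈ H, ρ h v = v) (g : G) :
    ρ g (cosetSum ρ H v) = cosetSum ρ H v := by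
  let _ := Fintype.ofFinite (G ⧸ H)
  unfold cosetSum
  rw [map_sum]
  conv_rhs => rw [← Equiv.sum_comp (MulAction.toPerm g : Equiv.Perm (G ⧸ H))]
  refine Finset.sum_congr rfl fun c _ => ?_
  have : (MulAction.toPerm g : Equiv.Perm (G ⧸ H)) c = QuotientGroup.mk (g * c.out) := by
    conv_lhs => rw [← QuotientGroup.out_eq' c]
    rfl
  rw [this, apply_out ρ H hv, map_mul, Module.End.mul_apply]

lemma cosetSum_trans [Finite G] (K : Subgroup G) (hHK : H ≤ K) {v : V} (hv : ∀ h ∈ H, ρ h v = v) :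
    cosetSum ρ H v = cosetSum ρ K (cosetSum (ρ.comp K.subtype) (H.subgroupOf K) v) := by
  let _ := Fintype.ofFinite (G ⧸ H)
  let _ := Fintype.ofFinite (G ⧸ K)
  let _ := Fintype.ofFinite (K ⧸ H.subgroupOf K)
  unfold cosetSum
  rw [← Equiv.sum_comp (Subgroup.quotientEquivProdOfLE hHK).symm, Fintype.sum_prod_type]
  refine Finset.sum_congr rfl fun c _ => ?_
  rw [map_sum]
  refine Finset.sum_congr rfl fun k _ => ?_
  have : (Subgroup.quotientEquivProdOfLE hHK).symm (c, k) =
      QuotientGroup.mk (c.out * (k.out : G)) := by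
    conv_lhs => rw [← QuotientGroup.out_eq' k]
    rfl
  rw [this, apply_out ρ H hv, map_mul]
  rfl

end CosetSum

/-! ### Σ-modules and the functor `Γ(M)` -/

/-- A `Σ`-module: a sequence of linear representations of the symmetric groups. -/
structure SigmaModule (F : Type u) [Field F] where
  /-- the component of arity `n` -/
  obj : ℕ → Type v
  [grp : ∀ n, AddCommGroup (obj n)]
  [mod : ∀ n, Module F (obj n)]
  /-- the action of the symmetric group on `n` letters -/
  rep : ∀ n, Representation F (Equiv.Perm (Fin n)) (obj n)

attribute [instance] SigmaModule.grp SigmaModule.mod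

section Gamma

variable {F : Type u} [Field F]

/-- The place permutation action on the tensor power `A^{⊗ n}`:
`σ · (a₁ ⊗ ⋯ ⊗ a_n) = a_{σ⁻¹(1)} ⊗ ⋯ ⊗ a_{σ⁻¹(n)}`. -/
def tensorRep (F : Type u) [Field F] (A : Type w) [AddCommGroup A] [Module F A] (n : ℕ) :
    Representation F (Equiv.Perm (Fin n)) (⨂[F] _ : Fin n, A) where
  toFun σ := (PiTensorProduct.reindex F (fun _ => A) σ).toLinearMap
  map_one' := by
    ext a
    simp [Equiv.Perm.one_def]
  map_mul' σ τ := by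
    ext a
    simp
    rfl

variable (M : SigmaModule.{u, v} F) (A : Type w) [AddCommGroup A] [Module F A]
  (B : Type w) [AddCommGroup B] [Module F B]

/-- The diagonal action on `M(n) ⊗ A^{⊗ n}`. -/
def diagRep (n : ℕ) :
    Representation F (Equiv.Perm (Fin n)) (M.obj n ⊗[F] (⨂[F] _ : Fin n, A)) :=
  Representation.tprod (M.rep n) (tensorRep F A n)

/-- `Γ(M, A) = ⨁_n (M(n) ⊗ A^{⊗ n})^{Σ_n}`. -/
abbrev Gamma : Type (max u v w) :=
  ⨁ n : ℕ, Representation.invariants (diagRep M A n)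

variable {A B}

lemma tensorRep_tprod {n : ℕ} (σ : Equiv.Perm (Fin n)) (a : Fin n → A) :
    tensorRep F A n σ (PiTensorProduct.tprod F a) =
      PiTensorProduct.tprod F (fun j => a (σ⁻¹ j)) := by
  simp [tensorRep]

lemma diagRep_tmul {n : ℕ} (σ : Equiv.Perm (Fin n)) (x : M.obj n) (a : Fin n → A) :
    diagRep M A n σ (x ⊗ₜ PiTensorProduct.tprod F a) =
      M.rep n σ x ⊗ₜ PiTensorProduct.tprod F (fun j => a (σ⁻¹ j)) := by
  rw [diagRep, Representation.tprod_apply, TensorProduct.map_tmul, tensorRep_tprod]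

/-- The map `id ⊗ g^{⊗ n}` on `M(n) ⊗ A^{⊗ n}`. -/
def tensorMap (g : A →ₗ[F] B) (n : ℕ) :
    (M.obj n ⊗[F] (⨂[F] _ : Fin n, A)) →ₗ[F] (M.obj n ⊗[F] (⨂[F] _ : Fin n, B)) :=
  TensorProduct.map LinearMap.id (PiTensorProduct.map fun _ => g)

lemma tensorMap_tmul (g : A →ₗ[F] B) {n : ℕ} (x : M.obj n) (a : Fin n → A) :
    tensorMap M g n (x ⊗ₜ PiTensorProduct.tprod F a) =
      x ⊗ₜ PiTensorProduct.tprod F (fun j => g (a j)) := by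
  simp [tensorMap]

lemma tensorMap_diagRep (g : A →ₗ[F] B) {n : ℕ} (σ : Equiv.Perm (Fin n))
    (t : M.obj n ⊗[F] (⨂[F] _ : Fin n, A)) :
    tensorMap M g n (diagRep M A n σ t) = diagRep M B n σ (tensorMap M g n t) := by
  have : tensorMap M g n ∘ₗ diagRep M A n σ = diagRep M B n σ ∘ₗ tensorMap M g n := by
    ext x a
    simp [diagRep_tmul, tensorMap_tmul]
  exact LinearMap.congr_fun this t

/-- `Γ(M, g) : Γ(M, A) → Γ(M, B)` for a linear map `g : A → B`. -/
def Gamma.map (g : A →ₗ[F] B) : Gamma M A →ₗ[F] Gamma M B :=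
  DirectSum.lmap fun n => (tensorMap M g n).restrict fun t ht σ => by
    rw [← tensorMap_diagRep, ht σ]

end Gamma

/-! ### Invariants of `M(n)` under Young subgroups -/

section Young

variable {F : Type u} [Field F] (M : SigmaModule.{u, v} F) {p s n : ℕ}

/-- The subspace `M(n)^{Σ_r}` of the elements of `M(n)` fixed by the Young subgroup of `r`. -/
def SigmaModule.inv (r : Comp p n) : Submodule F (M.obj n) :=
  Representation.invariants ((M.rep n).comp r.young.subtype)

variable {M}

lemma inv_apply {r : Comp p n} (x : M.inv r) (σ : Equiv.Perm (Fin n)) (hσ : σ ∈ r.young) :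
    M.rep n σ x.1 = x.1 :=
  x.2 ⟨σ, hσ⟩

/-- `x` seen as an element of `M(n)^{Σ_t}`, for a subgroup `Σ_t` of `Σ_r`. -/
def invOfLE {p' : ℕ} {r : Comp p n} {t : Comp p' n} (h : t.young ≤ r.young) (x : M.inv r) :
    M.inv t :=
  ⟨x.1, fun σ => inv_apply x σ.1 (h σ.2)⟩

/-- The element `ρ^* · x` of `M(n)^{Σ_{r^ρ}}`. -/
def invPerm (r : Comp p n) (ρ : Equiv.Perm (Fin p)) (x : M.inv r) : M.inv (r.perm ρ) :=
  ⟨M.rep n (r.blockPerm ρ) x.1, fun σ => by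
    have hmem : (r.blockPerm ρ)⁻¹ * σ.1 * r.blockPerm ρ ∈ r.young := by
      intro j
      apply ρ.injective
      rw [← r.block_blockPerm, ← r.block_blockPerm]
      have h := σ.2 (r.blockPerm ρ j)
      simpa using h
    have h := inv_apply x _ hmem
    change M.rep n σ.1 (M.rep n (r.blockPerm ρ) x.1) = _
    conv_rhs => rw [← h]
    simp only [← Module.End.mul_apply, ← map_mul]
    congr 2
    group⟩

/-- The element `∑_{σ ∈ Σ_{q ▷ r} / Σ_r} σ · x` of `M(n)^{Σ_{q ▷ r}}`. -/
def invMerge (q : Comp s p) (r : Comp p n) (x : M.inv r) : M.inv (q.merge r) :=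
  ⟨cosetSum ((M.rep n).comp (q.merge r).young.subtype)
      (r.young.subgroupOf (q.merge r).young) x.1,
    cosetSum_fixed _ _ fun h hh => inv_apply x h.1 hh⟩

end Young

/-! ### The two categories -/

section Categories

variable {F : Type u} [Field F]

/-- An object `(A, f)` of `Γ(M)_mod`: a vector space `A` and a linear map `f : Γ(M, A) → A`. -/
structure GammaMod (M : SigmaModule.{u, v} F) where
  /-- the underlying vector space -/
  carrier : Type w
  [grp : AddCommGroup carrier]
  [mod : Module F carrier]
  /-- the structure map -/
  str : Gamma M carrier →ₗ[F] carrier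

attribute [instance] GammaMod.grp GammaMod.mod

/-- A morphism of `Γ(M)_mod`: a linear map `g` with `f' ∘ Γ(M, g) = g ∘ f`. -/
@[ext]
structure GammaMod.Hom {M : SigmaModule.{u, v} F} (X Y : GammaMod.{u, v, w} M) where
  /-- the underlying linear map -/
  lin : X.carrier →ₗ[F] Y.carrier
  comm : Y.str ∘ₗ Gamma.map M lin = lin ∘ₗ X.str

lemma Gamma.map_id (M : SigmaModule.{u, v} F) (A : Type w) [AddCommGroup A] [Module F A] :
    Gamma.map M (LinearMap.id : A →ₗ[F] A) = LinearMap.id := by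
  refine DirectSum.linearMap_ext _ fun n => LinearMap.ext fun t => ?_
  simp only [Gamma.map, LinearMap.comp_apply, DirectSum.lmap_lof, LinearMap.id_apply]
  congr 1
  apply Subtype.ext
  simp [tensorMap, PiTensorProduct.map_id]

lemma Gamma.map_comp (M : SigmaModule.{u, v} F) {A B C : Type w} [AddCommGroup A] [Module F A]
    [AddCommGroup B] [Module F B] [AddCommGroup C] [Module F C] (h : B →ₗ[F] C) (g : A →ₗ[F] B) :
    Gamma.map M (h ∘ₗ g) = Gamma.map M h ∘ₗ Gamma.map M g := by
  refine DirectSum.linearMap_ext _ fun n => LinearMap.ext fun t => ?_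
  simp only [Gamma.map, LinearMap.comp_apply, DirectSum.lmap_lof]
  congr 1
  apply Subtype.ext
  have : tensorMap M (h ∘ₗ g) n = tensorMap M h n ∘ₗ tensorMap M g n := by
    ext x a
    simp [tensorMap_tmul]
  exact LinearMap.congr_fun this t.1

instance GammaMod.category (M : SigmaModule.{u, v} F) : Category (GammaMod.{u, v, w} M) where
  Hom X Y := GammaMod.Hom X Y
  id X := ⟨LinearMap.id, by rw [Gamma.map_id]; rfl⟩
  comp {X Y Z} g h := ⟨h.lin ∘ₗ g.lin, by
    rw [Gamma.map_comp, ← LinearMap.comp_assoc, h.comm, LinearMap.comp_assoc, g.comm,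
      LinearMap.comp_assoc]⟩

/-- A family of operations `β_{x,r} : A^p → A`, one for each composition `r` of an integer `n`
into `p` parts and each `x` in `M(n)^{Σ_r}`. -/
abbrev BetaOps (M : SigmaModule.{u, v} F) (A : Type w) : Type (max v w) :=
  ∀ {p n : ℕ} (r : Comp p n), M.inv r → (Fin p → A) → A

/-- The six relations that the operations `β_{x,r}` have to satisfy. -/
structure BetaRelations (M : SigmaModule.{u, v} F) (A : Type w) [AddCommGroup A] [Module F A]
    (β : BetaOps M A) : Prop where
  /-- `β_{x,r}((a_i)_i) = β_{ρ^*·x, r^ρ}((a_{ρ⁻¹(i)})_i)`. -/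
  perm : ∀ {p n : ℕ} (r : Comp p n) (ρ : Equiv.Perm (Fin p)) (x : M.inv r) (a : Fin p → A),
    β r x a = β (r.perm ρ) (invPerm r ρ x) (fun i => a (ρ⁻¹ i))
  /-- `β_{x,(0,r₁,…,r_p)}(a₀,a₁,…,a_p) = β_{x,(r₁,…,r_p)}(a₁,…,a_p)`. -/
  zero : ∀ {p n : ℕ} (r : Comp p n) (x : M.inv r) (a₀ : A) (a : Fin p → A),
    β r.zeroCons (invOfLE r.young_zeroCons.le x) (Fin.cons a₀ a) = β r x a
  /-- `β_{x,r}(c a₁,a₂,…,a_p) = c^{r₁} β_{x,r}(a₁,…,a_p)`. -/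
  smul : ∀ {p n : ℕ} (r : Comp (p + 1) n) (x : M.inv r) (c : F) (a₁ : A) (a : Fin p → A),
    β r x (Fin.cons (c • a₁) a) = c ^ r.parts 0 • β r x (Fin.cons a₁ a)
  /-- `β_{x,r}(a₁,…,a₁,…,a_s,…,a_s) = β_{∑ σ·x, q ▷ r}(a₁,…,a_s)`, where `a_i` is repeated `q_i`
  times and `σ` runs over `Σ_{q ▷ r} / Σ_r`. -/
  repeated : ∀ {p s n : ℕ} (q : Comp s p) (r : Comp p n) (x : M.inv r) (a : Fin s → A),
    β r x (fun j => a (q.block j)) = β (q.merge r) (invMerge q r x) a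
  /-- `β_{x,r}(a₀+a₁,a₂,…,a_p) = ∑_{l+m=r₁} β_{x,r∘₁(l,m)}(a₀,a₁,a₂,…,a_p)`. -/
  add : ∀ {p n : ℕ} (r : Comp (p + 1) n) (x : M.inv r) (a₀ a₁ : A) (a : Fin p → A),
    β r x (Fin.cons (a₀ + a₁) a) =
      ∑ lm : Finset.HasAntidiagonal.antidiagonal (r.parts 0),
        β (r.splitFirst lm) (invOfLE (r.young_splitFirst_le lm) x) (Fin.cons a₀ (Fin.cons a₁ a))
  /-- `β_{c x + y, r} = c β_{x,r} + β_{y,r}`. -/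
  lin : ∀ {p n : ℕ} (r : Comp p n) (c : F) (x y : M.inv r) (a : Fin p → A),
    β r (c • x + y) a = c • β r x a + β r y a

/-- An object `(A, β)` of the category `β(M)`. -/
structure BetaMod (M : SigmaModule.{u, v} F) where
  /-- the underlying vector space -/
  carrier : Type w
  [grp : AddCommGroup carrier]
  [mod : Module F carrier]
  /-- the operations -/
  op : BetaOps M carrier
  rel : BetaRelations M carrier op

attribute [instance] BetaMod.grp BetaMod.mod

/-- A morphism of `β(M)`: a linear map compatible with all the operations. -/
@[ext]
structure BetaMod.Hom {M : SigmaModule.{u, v} F} (X Y : BetaMod.{u, v, w} M) where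
  /-- the underlying linear map -/
  lin : X.carrier →ₗ[F] Y.carrier
  comm : ∀ {p n : ℕ} (r : Comp p n) (x : M.inv r) (a : Fin p → X.carrier),
    lin (X.op r x a) = Y.op r x (fun i => lin (a i))

instance BetaMod.category (M : SigmaModule.{u, v} F) : Category (BetaMod.{u, v, w} M) where
  Hom X Y := BetaMod.Hom X Y
  id X := ⟨LinearMap.id, fun _ _ _ => rfl⟩
  comp {X Y Z} g h := ⟨h.lin ∘ₗ g.lin, fun r x a => by
    rw [LinearMap.comp_apply, g.comm, h.comm]; rfl⟩

end Categories

/-! ### The functor `F_M` -/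

section FunctorF

variable {F : Type u} [Field F] {M : SigmaModule.{u, v} F} {A : Type w} [AddCommGroup A]
  [Module F A] {p s n : ℕ}

/-- The tensor `x ⊗ (a₁^{⊗ r₁} ⊗ ⋯ ⊗ a_p^{⊗ r_p})` of `M(n) ⊗ A^{⊗ n}`. -/
def blockTensor (r : Comp p n) (x : M.obj n) (a : Fin p → A) :
    M.obj n ⊗[F] (⨂[F] _ : Fin n, A) :=
  x ⊗ₜ PiTensorProduct.tprod F (fun j => a (r.block j))

lemma blockTensor_fixed (r : Comp p n) (x : M.inv r) (a : Fin p → A) (σ : Equiv.Perm (Fin n))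
    (hσ : σ ∈ r.young) :
    diagRep M A n σ (blockTensor r x.1 a) = blockTensor r x.1 a := by
  rw [blockTensor, diagRep_tmul, inv_apply x σ hσ]
  congr 2
  funext j
  rw [r.young.inv_mem hσ j]

/-- The element `∑_{σ ∈ Σ_n / Σ_r} σ·x ⊗ σ·(a₁^{⊗ r₁} ⊗ ⋯ ⊗ a_p^{⊗ r_p})` of
`(M(n) ⊗ A^{⊗ n})^{Σ_n}`. -/
def orbitElt (r : Comp p n) (x : M.inv r) (a : Fin p → A) :
    Representation.invariants (diagRep M A n) :=
  ⟨cosetSum (diagRep M A n) r.young (blockTensor r x.1 a),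
    cosetSum_fixed _ _ (blockTensor_fixed r x a)⟩

/-- The coefficient of `orbitElt r x a` along the tensor with `j`-th factor `a (d j)`. -/
def coef (r : Comp p n) (x : M.inv r) (d : Fin n → Fin p) : M.obj n :=
  letI := Fintype.ofFinite (Equiv.Perm (Fin n) ⧸ r.young)
  ∑ c : Equiv.Perm (Fin n) ⧸ r.young,
    if (fun j => r.block (c.out⁻¹ j)) = d then M.rep n c.out x.1 else 0

lemma orbitElt_eq (r : Comp p n) (x : M.inv r) (a : Fin p → A) :
    (orbitElt r x a).1 =
      ∑ d : Fin n → Fin p, coef r x d ⊗ₜ PiTensorProduct.tprod F (fun j => a (d j)) := by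
  let _ := Fintype.ofFinite (Equiv.Perm (Fin n) ⧸ r.young)
  simp only [orbitElt, cosetSum, coef, TensorProduct.sum_tmul]
  rw [Finset.sum_comm]
  refine Finset.sum_congr rfl fun c _ => ?_
  rw [Finset.sum_eq_single (fun j => r.block (c.out⁻¹ j))]
  · rw [if_pos rfl, blockTensor, diagRep_tmul]
  · intro d _ hd
    rw [if_neg (Ne.symm hd), TensorProduct.zero_tmul]
  · intro h
    exact absurd (Finset.mem_univ _) h

lemma coef_block (r : Comp p n) (x : M.inv r) (g : Equiv.Perm (Fin n)) (d : Fin n → Fin p)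
    (hd : ∀ j, d (g j) = r.block j) : coef r x d = M.rep n g x.1 := by
  let _ := Fintype.ofFinite (Equiv.Perm (Fin n) ⧸ r.young)
  simp only [coef]
  have hout := apply_out (M.rep n) r.young (inv_apply x) g
  obtain ⟨h, hh⟩ := QuotientGroup.mk_out_eq_mul r.young g
  rw [Finset.sum_eq_single (QuotientGroup.mk g)]
  · rw [if_pos, hout]
    funext j
    rw [hh, mul_inv_rev, Equiv.Perm.mul_apply, r.young.inv_mem h.2, ← hd]
    simp
  · intro c _ hc
    rw [if_neg]
    intro he
    apply hc
    rw [← QuotientGroup.out_eq' c]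
    refine QuotientGroup.eq.2 fun j => ?_
    rw [Equiv.Perm.mul_apply, congrFun he (g j), hd]
  · intro h
    exact absurd (Finset.mem_univ _) h

lemma exists_perm (r : Comp p n) (d : Fin n → Fin p)
    (hd : ∀ i, (Finset.univ.filter fun j => d j = i).card = r.parts i) :
    ∃ g : Equiv.Perm (Fin n), ∀ j, d (g j) = r.block j := by
  have e : ∀ i, {j // r.block j = i} ≃ {j // d j = i} := fun i =>
    Fintype.equivOfCardEq (by
      rw [Fintype.card_subtype, Fintype.card_subtype, hd, r.card_block])
  refine ⟨((Equiv.sigmaFiberEquiv r.block).symm.trans (Equiv.sigmaCongrRight e)).trans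
    (Equiv.sigmaFiberEquiv d), fun j => ?_⟩
  exact (e (r.block j) ⟨j, rfl⟩).2

lemma coef_eq_zero (r : Comp p n) (x : M.inv r) (d : Fin n → Fin p) (i : Fin p)
    (hd : (Finset.univ.filter fun j => d j = i).card ≠ r.parts i) : coef r x d = 0 := by
  let _ := Fintype.ofFinite (Equiv.Perm (Fin n) ⧸ r.young)
  refine Finset.sum_eq_zero fun c _ => if_neg ?_
  rintro rfl
  apply hd
  rw [← r.card_block i]
  refine Finset.card_nbij (fun j => c.out⁻¹ j) ?_ ?_ ?_
  · intro j hj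
    simpa using hj
  · intro j _ k _ h
    exact (c.out⁻¹).injective h
  · intro j hj
    refine ⟨c.out j, ?_, ?_⟩
    · simpa using hj
    · simp

lemma orbitElt_perm (r : Comp p n) (ρ : Equiv.Perm (Fin p)) (x : M.inv r) (a : Fin p → A) :
    orbitElt r x a = orbitElt (r.perm ρ) (invPerm r ρ x) (fun i => a (ρ⁻¹ i)) := by
  apply Subtype.ext
  rw [orbitElt_eq, orbitElt_eq]
  refine Fintype.sum_equiv ((Equiv.refl (Fin n)).arrowCongr ρ) _ _ fun d => ?_
  have h1 : coef (r.perm ρ) (invPerm r ρ x) ((Equiv.refl (Fin n)).arrowCongr ρ d) =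
      coef r x d := by
    by_cases hd : ∀ i, (Finset.univ.filter fun j => d j = i).card = r.parts i
    · obtain ⟨g, hg⟩ := exists_perm r d hd
      rw [coef_block r x g d hg, coef_block (r.perm ρ) _ (g * (r.blockPerm ρ)⁻¹)]
      · change M.rep n _ (M.rep n _ _) = _
        rw [← Module.End.mul_apply, ← map_mul, inv_mul_cancel_right]
      · intro j
        obtain ⟨k, rfl⟩ := (r.blockPerm ρ).surjective j
        rw [r.block_blockPerm, ← hg k]
        simp
    · push Not at hd
      obtain ⟨i, hi⟩ := hd
      rw [coef_eq_zero r x d i hi, coef_eq_zero (r.perm ρ) _ _ (ρ i)]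
      simpa [Comp.perm] using hi
  rw [h1]
  simp

lemma orbitElt_zero (r : Comp p n) (x : M.inv r) (a₀ : A) (a : Fin p → A) :
    orbitElt r.zeroCons (invOfLE r.young_zeroCons.le x) (Fin.cons a₀ a) = orbitElt r x a := by
  apply Subtype.ext
  have h : blockTensor r.zeroCons x.1 (Fin.cons a₀ a : Fin (p + 1) → A) = blockTensor r x.1 a := by
    simp [blockTensor, Comp.block_zeroCons]
  change cosetSum _ _ (blockTensor r.zeroCons x.1 (Fin.cons a₀ a : Fin (p + 1) → A)) = _
  rw [h, r.young_zeroCons]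
  rfl

lemma orbitElt_lin (r : Comp p n) (c : F) (x y : M.inv r) (a : Fin p → A) :
    orbitElt r (c • x + y) a = c • orbitElt r x a + orbitElt r y a := by
  apply Subtype.ext
  let _ := Fintype.ofFinite (Equiv.Perm (Fin n) ⧸ r.young)
  simp only [orbitElt, cosetSum, blockTensor, Submodule.coe_add, Submodule.coe_smul,
    TensorProduct.add_tmul, map_add, Finset.sum_add_distrib, Finset.smul_sum,
    ← TensorProduct.smul_tmul', map_smul]

lemma orbitElt_smul (r : Comp (p + 1) n) (x : M.inv r) (c : F) (a₁ : A) (a : Fin p → A) :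
    orbitElt r x (Fin.cons (c • a₁) a) = c ^ r.parts 0 • orbitElt r x (Fin.cons a₁ a) := by
  apply Subtype.ext
  have h : blockTensor r x.1 (Fin.cons (c • a₁) a : Fin (p + 1) → A) =
      c ^ r.parts 0 • blockTensor r x.1 (Fin.cons a₁ a : Fin (p + 1) → A) := by
    rw [blockTensor, blockTensor, ← TensorProduct.tmul_smul, ← r.card_block 0]
    have h1 : (fun j => (Fin.cons (c • a₁) a : Fin (p + 1) → A) (r.block j)) =
        fun j => (if r.block j = 0 then c else 1) •
          (Fin.cons a₁ a : Fin (p + 1) → A) (r.block j) := by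
      funext j
      generalize r.block j = k
      refine Fin.cases ?_ (fun k => ?_) k
      · simp
      · simp
    rw [h1, MultilinearMap.map_smul_univ, Finset.prod_ite]
    simp
  let _ := Fintype.ofFinite (Equiv.Perm (Fin n) ⧸ r.young)
  simp only [orbitElt, cosetSum, h, map_smul, Submodule.coe_smul, Finset.smul_sum]

lemma orbitElt_repeated (q : Comp s p) (r : Comp p n) (x : M.inv r) (a : Fin s → A) :
    orbitElt r x (fun j => a (q.block j)) = orbitElt (q.merge r) (invMerge q r x) a := by
  apply Subtype.ext
  change cosetSum _ _ _ = cosetSum _ _ _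
  rw [cosetSum_trans (diagRep M A n) r.young (q.merge r).young (Comp.young_le_merge q r)
    (blockTensor_fixed r x _)]
  congr 1
  let _ := Fintype.ofFinite
    ((q.merge r).young ⧸ r.young.subgroupOf (q.merge r).young)
  simp only [invMerge, cosetSum, blockTensor, TensorProduct.sum_tmul, Comp.block_merge]
  refine Finset.sum_congr rfl fun c _ => ?_
  refine (diagRep_tmul M _ _ _).trans ?_
  congr 2
  funext j
  rw [← Comp.block_merge, ← Comp.block_merge]
  exact congrArg a ((q.merge r).young.inv_mem c.out.2 j)

lemma coef_add (r : Comp (p + 1) n) (x : M.inv r) (e : Fin n → Fin (p + 2)) :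
    coef r x (fun j => Fin.predAbove 0 (e j)) =
      ∑ lm : Finset.HasAntidiagonal.antidiagonal (r.parts 0),
        coef (r.splitFirst lm) (invOfLE (r.young_splitFirst_le lm) x) e := by
  by_cases hd : ∀ i, (Finset.univ.filter fun j => Fin.predAbove 0 (e j) = i).card = r.parts i
  · have h0 : (Finset.univ.filter fun j => e j = 0).card +
        (Finset.univ.filter fun j => e j = 1).card = r.parts 0 := by
      rw [← hd 0, ← Finset.card_union_of_disjoint]
      · congr 1
        ext j
        simp only [Finset.mem_filter, Finset.mem_univ, true_and, Finset.mem_union]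
        generalize e j = k
        refine Fin.cases ?_ (fun k => ?_) k
        · simp
        · rw [← Fin.succ_zero_eq_one, Fin.succ_inj]
          simp
      · rw [Finset.disjoint_left]
        intro j hj hj'
        simp only [Finset.mem_filter, Finset.mem_univ, true_and] at hj hj'
        rw [hj] at hj'
        simp at hj'
    have hs : ∀ i : Fin p, (Finset.univ.filter fun j => e j = i.succ.succ).card =
        r.parts i.succ := by
      intro i
      rw [← hd i.succ]
      congr 1
      ext j
      simp only [Finset.mem_filter, Finset.mem_univ, true_and]
      generalize e j = k
      refine Fin.cases ?_ (fun k => ?_) k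
      · simp [Fin.ext_iff]
      · simp
    let lm : Finset.HasAntidiagonal.antidiagonal (r.parts 0) :=
      ⟨(_, _), Finset.HasAntidiagonal.mem_antidiagonal.2 h0⟩
    rw [Finset.sum_eq_single lm]
    · obtain ⟨g, hg⟩ := exists_perm (r.splitFirst lm) e (by
        intro i
        refine Fin.cases rfl (fun i => ?_) i
        exact Fin.cases rfl (fun i => hs i) i)
      rw [coef_block _ _ g e hg, coef_block r x g]
      · rfl
      · intro j
        rw [hg, r.block_splitFirst]
    · intro lm' _ hne
      by_cases h : (Finset.univ.filter fun j => e j = 0).card = lm'.1.1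
      · refine coef_eq_zero _ _ _ 1 fun h' => hne ?_
        exact Subtype.ext (Prod.ext h.symm h'.symm)
      · exact coef_eq_zero _ _ _ 0 h
    · intro h
      exact absurd (Finset.mem_univ _) h
  · push Not at hd
    obtain ⟨i, hi⟩ := hd
    rw [coef_eq_zero r x _ i hi]
    symm
    refine Finset.sum_eq_zero fun lm _ => ?_
    by_cases he : ∀ i, (Finset.univ.filter fun j => e j = i).card = (r.splitFirst lm).parts i
    · obtain ⟨g, hg⟩ := exists_perm (r.splitFirst lm) e he
      exfalso
      apply hi
      rw [← r.card_block i]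
      symm
      refine Finset.card_nbij (fun j => g j) ?_ ?_ ?_
      · intro j hj
        simpa [hg, r.block_splitFirst] using hj
      · intro j _ k _ h
        exact g.injective h
      · intro j hj
        obtain ⟨k, rfl⟩ := g.surjective j
        exact ⟨k, by simpa [hg, r.block_splitFirst] using hj, rfl⟩
    · push Not at he
      obtain ⟨k, hk⟩ := he
      exact coef_eq_zero _ _ _ k hk

lemma orbitElt_add (r : Comp (p + 1) n) (x : M.inv r) (a₀ a₁ : A) (a : Fin p → A) :
    orbitElt r x (Fin.cons (a₀ + a₁) a) =
      ∑ lm : Finset.HasAntidiagonal.antidiagonal (r.parts 0),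
        orbitElt (r.splitFirst lm) (invOfLE (r.young_splitFirst_le lm) x)
          (Fin.cons a₀ (Fin.cons a₁ a)) := by
  apply Subtype.ext
  rw [Submodule.coe_sum]
  simp only [orbitElt_eq]
  rw [Finset.sum_comm]
  simp only [← TensorProduct.sum_tmul, ← coef_add]
  set a' : Fin (p + 2) → A := Fin.cons a₀ (Fin.cons a₁ a) with ha'
  have hsum : ∀ k : Fin (p + 1), (Fin.cons (a₀ + a₁) a : Fin (p + 1) → A) k =
      ∑ i with Fin.predAbove 0 i = k, a' i := by
    intro k
    rw [Finset.sum_filter, Fin.sum_univ_succ, Fin.sum_univ_succ]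
    refine Fin.cases ?_ (fun k => ?_) k
    · simp [ha']
    · have h0 : (0 : Fin (p + 1)) ≠ k.succ := (Fin.succ_ne_zero k).symm
      simp [ha', h0, Finset.sum_ite_eq']
  have hexp : ∀ d : Fin n → Fin (p + 1),
      PiTensorProduct.tprod F (fun j => (Fin.cons (a₀ + a₁) a : Fin (p + 1) → A) (d j)) =
        ∑ e : Fin n → Fin (p + 2), if (fun j => Fin.predAbove 0 (e j)) = d then
          PiTensorProduct.tprod F (fun j => a' (e j)) else 0 := by
    intro d
    simp only [hsum]
    rw [MultilinearMap.map_sum_finset, ← Finset.sum_filter]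
    refine Finset.sum_congr ?_ fun _ _ => rfl
    ext e
    simp [Fintype.mem_piFinset, funext_iff]
  simp only [hexp, TensorProduct.tmul_sum]
  rw [Finset.sum_comm]
  refine Finset.sum_congr rfl fun e _ => ?_
  rw [Finset.sum_eq_single (fun j => Fin.predAbove 0 (e j))]
  · rw [if_pos rfl]
  · intro d _ hd
    rw [if_neg (Ne.symm hd), TensorProduct.tmul_zero]
  · intro h
    exact absurd (Finset.mem_univ _) h

lemma tensorMap_orbitElt {B : Type w} [AddCommGroup B] [Module F B] (g : A →ₗ[F] B)
    (r : Comp p n) (x : M.inv r) (a : Fin p → A) :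
    tensorMap M g n (orbitElt r x a).1 = (orbitElt r x (fun i => g (a i))).1 := by
  let _ := Fintype.ofFinite (Equiv.Perm (Fin n) ⧸ r.young)
  simp only [orbitElt, cosetSum, map_sum, tensorMap_diagRep, blockTensor, tensorMap_tmul]

/-- The operation
`β_{x,r}(a₁,…,a_p) = f(∑_{σ ∈ Σ_n/Σ_r} σ·x ⊗ σ·(a₁^{⊗ r₁} ⊗ ⋯ ⊗ a_p^{⊗ r_p}))`. -/
def GammaMod.op (X : GammaMod.{u, v, w} M) : BetaOps M X.carrier := fun {_ n} r x a =>
  X.str (DirectSum.lof F ℕ (fun n => Representation.invariants (diagRep M X.carrier n)) n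
    (orbitElt r x a))

lemma GammaMod.op_rel (X : GammaMod.{u, v, w} M) : BetaRelations M X.carrier X.op where
  perm r ρ x a := by simp only [GammaMod.op]; rw [orbitElt_perm r ρ x a]
  zero r x a₀ a := by simp only [GammaMod.op]; rw [orbitElt_zero]
  smul r x c a₁ a := by simp only [GammaMod.op]; rw [orbitElt_smul, map_smul, map_smul]
  repeated q r x a := by simp only [GammaMod.op]; rw [orbitElt_repeated]
  add r x a₀ a₁ a := by simp only [GammaMod.op]; rw [orbitElt_add, map_sum, map_sum]
  lin r c x y a := by
    simp only [GammaMod.op]; rw [orbitElt_lin, map_add, map_add, map_smul, map_smul]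

/-- The functor `F_M : Γ(M)_mod → β(M)`, `(A, f) ↦ (A, β)`, which is the identity on the
underlying vector spaces and linear maps. -/
def functorF (M : SigmaModule.{u, v} F) : GammaMod.{u, v, w} M ⥤ BetaMod.{u, v, w} M where
  obj X := ⟨X.carrier, X.op, X.op_rel⟩
  map {X Y} g := ⟨g.lin, fun {p n} r x a => by
    have h := LinearMap.congr_fun g.comm (DirectSum.lof F ℕ
      (fun n => Representation.invariants (diagRep M X.carrier n)) n (orbitElt r x a))
    refine h.symm.trans ?_
    simp only [GammaMod.op, LinearMap.comp_apply, Gamma.map, DirectSum.lmap_lof]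
    congr 2
    exact Subtype.ext (tensorMap_orbitElt g.lin r x a)⟩

end FunctorF

end DividedPower

end

namespace DividedPower

noncomputable section

variable {F : Type u} [Field F] {M : SigmaModule.{u, v} F} {A : Type w} [AddCommGroup A]
  [Module F A] {p s n : ℕ}

/-! ### Compositions -/

/-! The point is that the orbit elements `orbitElt r x a` generate the invariants, and that the
relations (β1)–(β6) account for every linear dependence among them. Fix a basis of `A`. An invariant
tensor has coordinates in `M(n)` indexed by words in the basis, and invariance makes this family
equivariant. It is therefore determined by its values on sorted words, where the value at the block
word of `r` is an arbitrary element of `M(n)^{Σ_r}`. Hence orbit elements on distinct basis vectors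
span (`exists_sum_orbitElt_basis`) and are independent (`eq_zero_of_sum_orbitElt_eq_zero`). Spanning
shows that `f` is determined by its operations. Conversely, given `β`, the map `f` is built through
its graph. For each tuple `a`, let `opGraph β n a` be the span of the pairs (orbit element, value of
`β`). By (β1) and (β4) it can only grow when `a` is replaced by a tuple with more entries, up to
reordering and repetition. By (β2), (β3) and (β5), entries can be replaced by the basis vectors
occurring in them. So every graph lies in one over distinct basis vectors, where independence and
(β6) leave only the value 0 above 0 (`eq_zero_of_mem_opGraph`). Any two graphs lie in that of the
concatenated tuple, so their union is the graph of a linear map. No division takes place, so the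
characteristic plays no role. -/

lemma Comp.ext_parts {r t : Comp p n} (h : ∀ i, r.parts i = t.parts i) : r = t := by
  obtain ⟨a, ha⟩ := r
  obtain ⟨b, hb⟩ := t
  obtain rfl : a = b := funext h
  rfl

instance Comp.instFinite : Finite (Comp p n) := by
  refine Finite.of_injective (β := Fin p → Fin (n + 1)) (fun r i => ⟨r.parts i, ?_⟩) ?_
  · have h := Finset.single_le_sum (f := r.parts) (fun _ _ => Nat.zero_le _) (Finset.mem_univ i)
    rw [r.sum_parts] at h
    omega
  · intro r t h
    exact Comp.ext_parts fun i => congrArg Fin.val (congrFun h i)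

instance Comp.instFintype : Fintype (Comp p n) := Fintype.ofFinite _

/-- The composition recording the sizes of the fibres of a function. -/
def Comp.ofFun (d : Fin n → Fin p) : Comp p n :=
  ⟨fun i => (Finset.univ.filter fun j => d j = i).card, by
    rw [← Finset.card_eq_sum_card_fiberwise (fun j _ => Finset.mem_coe.2 (Finset.mem_univ (d j)))]
    simp⟩

lemma Comp.exists_parts_ne {r t : Comp p n} (h : r ≠ t) : ∃ i, r.parts i ≠ t.parts i := by
  by_contra! h'
  exact h (Comp.ext_parts h')

/-- Every map between finite ordinals is a block function up to a permutation of the source. -/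
lemma Comp.exists_eq_block_comp (h : Fin p → Fin s) :
    ∃ (q : Comp s p) (ρ : Equiv.Perm (Fin p)), ∀ j, h j = q.block (ρ⁻¹ j) := by
  -- Sorting makes `h` monotone, and a monotone function is the block function of its fibre sizes.
  -- Values not taken by `h` give parts equal to 0.
  refine ⟨Comp.ofFun (h ∘ Tuple.sort h), Tuple.sort h, fun j => ?_⟩
  rw [← Comp.eq_block _ _ (Tuple.monotone_sort h) fun i => rfl]
  simp

/-! ### Coefficients -/

lemma coef_block_self (r : Comp p n) (x : M.inv r) : coef r x r.block = x.1 := by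
  rw [coef_block r x 1 _ fun _ => rfl, map_one, Module.End.one_apply]

/-- With `coef_block_self`, this triangularity lets each `x r` be read off from a sum of orbit
elements over all compositions. -/
lemma coef_block_of_ne {r t : Comp p n} (x : M.inv r) (h : r ≠ t) : coef r x t.block = 0 := by
  obtain ⟨i, hi⟩ := Comp.exists_parts_ne h
  exact coef_eq_zero r x _ i (by rw [t.card_block]; exact hi.symm)

/-- A family `T` of elements of `M(n)` indexed by functions `Fin n → Fin p`, equivariant for the
symmetric group, is determined by its values on block functions. -/
lemma sum_coef_of_equivariant (T : (Fin n → Fin p) → M.obj n)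
    (hT : ∀ (σ : Equiv.Perm (Fin n)) (d : Fin n → Fin p), M.rep n σ (T fun j => d (σ j)) = T d)
    (x : ∀ r : Comp p n, M.inv r) (hx : ∀ r, (x r).1 = T r.block) (d : Fin n → Fin p) :
    ∑ r, coef r (x r) d = T d := by
  -- A coefficient at `d` vanishes unless the fibres of `d` have the sizes prescribed by `r`, so one
  -- composition survives. There `d` is a permuted block function and equivariance moves the value.
  rw [Finset.sum_eq_single (Comp.ofFun d)]
  · obtain ⟨g, hg⟩ := exists_perm (Comp.ofFun d) d fun _ => rfl
    rw [coef_block _ _ g d hg, hx, ← hT g d]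
    simp only [hg]
  · intro r _ hr
    obtain ⟨i, hi⟩ := Comp.exists_parts_ne hr
    exact coef_eq_zero r _ _ i hi.symm
  · intro h
    exact absurd (Finset.mem_univ _) h

/-! ### Coordinates in `M(n) ⊗ A^{⊗ n}` -/

section Coordinates

variable {ι : Type*} (e : Module.Basis ι F A)

open Classical in
/-- The coordinates of an element of `M(n) ⊗ A^{⊗ n}` with respect to a basis of `A`. -/
def tensorCoord (M : SigmaModule.{u, v} F) (n : ℕ) :
    (M.obj n ⊗[F] (⨂[F] _ : Fin n, A)) ≃ₗ[F] ((Fin n → ι) →₀ M.obj n) :=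
  TensorProduct.equivFinsuppOfBasisRight (Basis.piTensorProduct fun _ : Fin n => e)

lemma tensorCoord_tmul (x : M.obj n) (a : Fin n → A) (d : Fin n → ι) :
    tensorCoord e M n (x ⊗ₜ PiTensorProduct.tprod F a) d = (∏ j, e.repr (a j) (d j)) • x := by
  classical
  rw [tensorCoord, TensorProduct.equivFinsuppOfBasisRight_apply_tmul_apply,
    Basis.piTensorProduct_repr_tprod_apply]

lemma tensorCoord_tmul_basis [DecidableEq ι] (x : M.obj n) (c d : Fin n → ι) :
    tensorCoord e M n (x ⊗ₜ PiTensorProduct.tprod F fun j => e (c j)) d =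
      if c = d then x else 0 := by
  rw [tensorCoord_tmul]
  split_ifs with h
  · subst h
    simp
  · obtain ⟨j, hj⟩ := Function.ne_iff.1 h
    rw [Finset.prod_eq_zero (Finset.mem_univ j), zero_smul]
    simp [hj]

/-- For an invariant `t` this says that its coordinates form an equivariant family, as required by
`sum_coef_of_equivariant`. -/
lemma tensorCoord_diagRep (σ : Equiv.Perm (Fin n)) (t : M.obj n ⊗[F] (⨂[F] _ : Fin n, A))
    (d : Fin n → ι) :
    tensorCoord e M n (diagRep M A n σ t) d =
      M.rep n σ (tensorCoord e M n t fun j => d (σ j)) := by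
  have : Finsupp.lapply d ∘ₗ (tensorCoord e M n).toLinearMap ∘ₗ diagRep M A n σ =
      M.rep n σ ∘ₗ Finsupp.lapply (fun j => d (σ j)) ∘ₗ (tensorCoord e M n).toLinearMap := by
    ext x a
    simp only [TensorProduct.AlgebraTensorModule.curry_apply, TensorProduct.curry_apply,
      LinearMap.compMultilinearMap_apply, LinearMap.coe_restrictScalars, LinearMap.comp_apply,
      LinearEquiv.coe_coe, Finsupp.lapply_apply, diagRep_tmul, tensorCoord_tmul, map_smul]
    congr 1
    rw [← Equiv.prod_comp σ]
    exact Finset.prod_congr rfl fun j _ => by rw [show σ⁻¹ (σ j) = j from σ.symm_apply_apply j]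
  exact LinearMap.congr_fun this t

lemma tensorCoord_orbitElt [DecidableEq ι] (r : Comp p n) (x : M.inv r) (c : Fin p → ι)
    (D : Fin n → ι) :
    tensorCoord e M n (orbitElt r x fun i => e (c i)).1 D =
      ∑ d : Fin n → Fin p, if (fun j => c (d j)) = D then coef r x d else 0 := by
  rw [orbitElt_eq, map_sum, Finsupp.finsetSum_apply]
  exact Finset.sum_congr rfl fun d _ => tensorCoord_tmul_basis e _ _ _

/-- When the basis vectors are distinct, different words `d` give different basis tensors, so no two
coefficients are added together. -/
lemma tensorCoord_orbitElt_comp (r : Comp p n) (x : M.inv r) {c : Fin p → ι}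
    (hc : Function.Injective c) (d : Fin n → Fin p) :
    tensorCoord e M n (orbitElt r x fun i => e (c i)).1 (fun j => c (d j)) = coef r x d := by
  classical
  rw [tensorCoord_orbitElt, Finset.sum_eq_single d]
  · rw [if_pos rfl]
  · intro d' _ hne
    rw [if_neg]
    intro h
    exact hne (funext fun j => hc (congrFun h j))
  · intro h
    exact absurd (Finset.mem_univ _) h

/-- The orbit elements on pairwise distinct basis vectors are linearly independent. -/
lemma eq_zero_of_sum_orbitElt_eq_zero {c : Fin p → ι} (hc : Function.Injective c)
    (x : ∀ r : Comp p n, M.inv r) (h : ∑ r, orbitElt r (x r) (fun i => e (c i)) = 0)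
    (r : Comp p n) : x r = 0 := by
  apply Subtype.ext
  have h' := congrArg
    (fun t => tensorCoord e M n t.1 (fun j => c (r.block j))) h
  simp only [Submodule.coe_sum, map_sum, Finsupp.finsetSum_apply,
    tensorCoord_orbitElt_comp e _ _ hc, ZeroMemClass.coe_zero, map_zero, Finsupp.zero_apply] at h'
  rw [Finset.sum_eq_single r (fun t _ ht => coef_block_of_ne (x t) ht) fun h => absurd
    (Finset.mem_univ _) h, coef_block_self] at h'
  exact h'

/-- Every invariant is a sum of orbit elements on basis vectors. -/
lemma exists_sum_orbitElt_basis (t : Representation.invariants (diagRep M A n)) :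
    ∃ (p : ℕ) (c : Fin p → ι) (x : ∀ r : Comp p n, M.inv r),
      t = ∑ r, orbitElt r (x r) (fun i => e (c i)) := by
  classical
  -- The finitely many basis indices occurring in `t`, enumerated without repetition by `c`.
  let S : Finset ι := (tensorCoord e M n t.1).support.biUnion fun D => Finset.univ.image D
  let c : Fin S.card → ι := fun i => (S.equivFin.symm i).1
  have hc : Function.Injective c := Subtype.val_injective.comp S.equivFin.symm.injective
  let T : (Fin n → Fin S.card) → M.obj n := fun d => tensorCoord e M n t.1 fun j => c (d j)
  have hT : ∀ (σ : Equiv.Perm (Fin n)) (d : Fin n → Fin S.card),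
      M.rep n σ (T fun j => d (σ j)) = T d := by
    intro σ d
    change M.rep n σ (tensorCoord e M n t.1 fun j => c (d (σ j))) = _
    rw [← tensorCoord_diagRep e σ t.1 fun j => c (d j), t.2 σ]
  -- `T r.block` is fixed by the Young subgroup because `r.block` is unchanged by precomposition
  -- with its elements.
  let x : ∀ r : Comp S.card n, M.inv r := fun r => ⟨T r.block, fun σ => by
    change M.rep n σ.1 (T r.block) = _
    conv_rhs => rw [← hT σ.1]
    congr 2
    funext j
    exact (σ.2 j).symm⟩
  refine ⟨S.card, c, x, Subtype.ext ((tensorCoord e M n).injective (Finsupp.ext fun D => ?_))⟩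
  rw [Submodule.coe_sum, map_sum, Finsupp.finsetSum_apply]
  -- A word with a letter outside `S` has coordinate 0 on both sides; any other word factors through
  -- `c`.
  by_cases hD : ∀ j, D j ∈ S
  · obtain ⟨d, rfl⟩ : ∃ d : Fin n → Fin S.card, (fun j => c (d j)) = D :=
      ⟨fun j => S.equivFin ⟨D j, hD j⟩, by simp [c]⟩
    simp only [tensorCoord_orbitElt_comp e _ _ hc]
    exact (sum_coef_of_equivariant T hT x (fun _ => rfl) d).symm
  · obtain ⟨j, hj⟩ := not_forall.1 hD
    have h0 : tensorCoord e M n t.1 D = 0 := by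
      by_contra h
      exact hj (Finset.mem_biUnion.2 ⟨D, Finsupp.mem_support_iff.2 h,
        Finset.mem_image_of_mem D (Finset.mem_univ j)⟩)
    rw [h0]
    symm
    refine Finset.sum_eq_zero fun r _ => ?_
    rw [tensorCoord_orbitElt]
    refine Finset.sum_eq_zero fun d _ => if_neg ?_
    rintro rfl
    exact hj (S.equivFin.symm (d j)).2

end Coordinates

/-! ### The graph of the structure map -/

/-- The span of the pairs `(orbitElt r x a, β_{x,r}(a))` for a fixed tuple `a`. -/
def opGraph (β : BetaOps M A) (n : ℕ) (a : Fin p → A) :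
    Submodule F (Representation.invariants (diagRep M A n) × A) :=
  Submodule.span F {w | ∃ (r : Comp p n) (x : M.inv r), w = (orbitElt r x a, β r x a)}

section Graph

variable {β : BetaOps M A}

lemma mem_opGraph (r : Comp p n) (x : M.inv r) (a : Fin p → A) :
    (orbitElt r x a, β r x a) ∈ opGraph β n a :=
  Submodule.subset_span ⟨r, x, rfl⟩

lemma opGraph_le {a : Fin p → A}
    {N : Submodule F (Representation.invariants (diagRep M A n) × A)}
    (h : ∀ (r : Comp p n) (x : M.inv r), (orbitElt r x a, β r x a) ∈ N) : opGraph β n a ≤ N := by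
  refine Submodule.span_le.2 ?_
  rintro _ ⟨r, x, rfl⟩
  exact h r x

lemma BetaRelations.op_zero (hβ : BetaRelations M A β) (r : Comp p n) (a : Fin p → A) :
    β r 0 a = 0 := by
  have h := hβ.lin r 1 0 0 a
  rwa [smul_zero, add_zero, one_smul, left_eq_add] at h

lemma BetaRelations.op_add (hβ : BetaRelations M A β) (r : Comp p n) (x y : M.inv r)
    (a : Fin p → A) : β r (x + y) a = β r x a + β r y a := by
  have h := hβ.lin r 1 x y a
  rwa [one_smul, one_smul] at h

lemma BetaRelations.op_smul (hβ : BetaRelations M A β) (r : Comp p n) (c : F) (x : M.inv r)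
    (a : Fin p → A) : β r (c • x) a = c • β r x a := by
  have h := hβ.lin r c x 0 a
  rwa [add_zero, hβ.op_zero, add_zero] at h

/-- The linear map `x ↦ (orbitElt r x a, β_{x,r}(a))`. -/
def orbitPair (hβ : BetaRelations M A β) (r : Comp p n) (a : Fin p → A) :
    M.inv r →ₗ[F] Representation.invariants (diagRep M A n) × A where
  toFun x := (orbitElt r x a, β r x a)
  map_add' x y := by
    have h := orbitElt_lin r 1 x y a
    rw [one_smul, one_smul] at h
    rw [h, hβ.op_add, Prod.mk_add_mk]
  map_smul' c x := by
    -- `orbitElt_lin` at `1 • 0 + 0` forces the orbit element of 0 to vanish; homogeneity then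
    -- follows by taking `y = 0`.
    have h0 := orbitElt_lin r 1 0 0 a (M := M)
    rw [smul_zero, add_zero, one_smul, left_eq_add] at h0
    have h := orbitElt_lin r c x 0 a
    rw [add_zero, h0, add_zero] at h
    rw [h, hβ.op_smul, RingHom.id_apply, Prod.smul_mk]

/-- By (β6) the pairs for a given `r` already form a subspace, the range of `orbitPair`. The span is
the sum of these ranges over the finitely many `r`, so one `x r` per composition is enough. -/
lemma exists_sum_of_mem_opGraph (hβ : BetaRelations M A β) {a : Fin p → A}
    {w : Representation.invariants (diagRep M A n) × A} (hw : w ∈ opGraph β n a) :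
    ∃ x : ∀ r : Comp p n, M.inv r, w = ∑ r, orbitPair hβ r a (x r) := by
  classical
  have hle : opGraph β n a ≤ LinearMap.range (LinearMap.lsum F (fun r : Comp p n => M.inv r) F
      fun r => orbitPair hβ r a) := by
    refine opGraph_le fun r x => ⟨Pi.single r x, ?_⟩
    rw [LinearMap.lsum_piSingle]
    rfl
  obtain ⟨x, rfl⟩ := hle hw
  exact ⟨x, by simp [LinearMap.lsum_apply]⟩

lemma opGraph_perm_le (hβ : BetaRelations M A β) (ρ : Equiv.Perm (Fin p)) (a : Fin p → A) :
    opGraph β n a ≤ opGraph β n (fun i => a (ρ⁻¹ i)) := by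
  refine opGraph_le fun r x => ?_
  rw [orbitElt_perm r ρ x a, hβ.perm r ρ x a]
  exact mem_opGraph _ _ _

lemma opGraph_block_le (hβ : BetaRelations M A β) (q : Comp s p) (a : Fin s → A) :
    opGraph β n (fun j => a (q.block j)) ≤ opGraph β n a := by
  refine opGraph_le fun r x => ?_
  rw [orbitElt_repeated q r x a, hβ.repeated q r x a]
  exact mem_opGraph _ _ _

/-- A reindexing is a permutation followed by a block function, so (β1) and (β4) suffice. Empty
blocks are allowed, so `h` need not be surjective and unused entries of `a` do no harm. -/
lemma opGraph_comp_le (hβ : BetaRelations M A β) (h : Fin p → Fin s) (a : Fin s → A) :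
    opGraph β n (fun j => a (h j)) ≤ opGraph β n a := by
  obtain ⟨q, ρ, hq⟩ := Comp.exists_eq_block_comp h
  refine (opGraph_perm_le hβ ρ⁻¹ _).trans ?_
  simp only [hq, inv_inv, ← Equiv.Perm.mul_apply, inv_mul_cancel, Equiv.Perm.one_apply]
  exact opGraph_block_le hβ q a

lemma opGraph_le_of_range_subset (hβ : BetaRelations M A β) {a : Fin p → A} {b : Fin s → A}
    (h : Set.range a ⊆ Set.range b) : opGraph β n a ≤ opGraph β n b := by
  choose k hk using fun i => h (Set.mem_range_self i)
  obtain rfl : (fun i => b (k i)) = a := funext hk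
  exact opGraph_comp_le hβ k b

lemma opGraph_cons_add_le (hβ : BetaRelations M A β) (a₀ a₁ : A) (a : Fin p → A) :
    opGraph β n (Fin.cons (a₀ + a₁) a : Fin (p + 1) → A) ≤
      opGraph β n (Fin.cons a₀ (Fin.cons a₁ a : Fin (p + 1) → A) : Fin (p + 2) → A) := by
  refine opGraph_le fun r x => ?_
  rw [orbitElt_add, hβ.add, prod_mk_sum]
  exact Submodule.sum_mem _ fun lm _ => mem_opGraph _ _ _

lemma opGraph_cons_smul_le (hβ : BetaRelations M A β) (c : F) (a₁ : A) (a : Fin p → A) :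
    opGraph β n (Fin.cons (c • a₁) a : Fin (p + 1) → A) ≤
      opGraph β n (Fin.cons a₁ a : Fin (p + 1) → A) := by
  refine opGraph_le fun r x => ?_
  rw [orbitElt_smul, hβ.smul, ← Prod.smul_mk]
  exact Submodule.smul_mem _ _ (mem_opGraph _ _ _)

lemma Comp.exists_eq_zeroCons (r : Comp (p + 1) n) (h : r.parts 0 = 0) :
    ∃ t : Comp p n, r = t.zeroCons := by
  refine ⟨⟨Fin.tail r.parts, ?_⟩, Comp.ext_parts fun i => ?_⟩
  · have := r.sum_parts
    rwa [Fin.sum_univ_succ, h, zero_add] at this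
  · exact Fin.cases h (fun _ => rfl) i

lemma opGraph_cons_zero_le (hβ : BetaRelations M A β) (a : Fin p → A) :
    opGraph β n (Fin.cons 0 a : Fin (p + 1) → A) ≤ opGraph β n a := by
  refine opGraph_le fun r x => ?_
  -- If 0 is not used, (β2) drops it. Otherwise (β3) with scalar 0 kills both the orbit element and
  -- the operation, since `0 ^ r₁ = 0`.
  by_cases h : r.parts 0 = 0
  · obtain ⟨t, rfl⟩ := r.exists_eq_zeroCons h
    have h1 := orbitElt_zero t (invOfLE t.young_zeroCons.ge x) 0 a
    have h2 := hβ.zero t (invOfLE t.young_zeroCons.ge x) 0 a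
    -- `invOfLE` changes only the proof of invariance, so passing to `t` and back returns `x`.
    change orbitElt _ x _ = _ at h1
    change β _ x _ = _ at h2
    rw [h1, h2]
    exact mem_opGraph _ _ _
  · have h1 := orbitElt_smul r x (0 : F) 0 a
    have h2 := hβ.smul r x (0 : F) 0 a
    rw [smul_zero, zero_pow h, zero_smul] at h1 h2
    rw [h1, h2]
    exact Submodule.zero_mem _

/-- Adjoining a vector `z` to a tuple containing the basis vectors occurring in `z` does not
enlarge the graph. -/
lemma exists_opGraph_cons_le (hβ : BetaRelations M A β) {ι : Type*} (e : Module.Basis ι F A)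
    (z : A) :
    ∃ S : Finset ι, ∀ (p : ℕ) (a : Fin p → A), (∀ i ∈ S, e i ∈ Set.range a) →
      opGraph β n (Fin.cons z a : Fin (p + 1) → A) ≤ opGraph β n a := by
  classical
  have hz : z ∈ Submodule.span F (Set.range e) := e.mem_span z
  induction hz using Submodule.span_induction with
  | mem z hz =>
    obtain ⟨i, rfl⟩ := hz
    refine ⟨{i}, fun p a ha => opGraph_le_of_range_subset hβ ?_⟩
    rw [Fin.range_cons]
    exact Set.insert_subset (ha i (Finset.mem_singleton_self i)) subset_rfl
  | zero => exact ⟨∅, fun p a _ => opGraph_cons_zero_le hβ a⟩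
  | add y z _ _ hy hz =>
    obtain ⟨S, hS⟩ := hy
    obtain ⟨S', hS'⟩ := hz
    refine ⟨S ∪ S', fun p a ha => (opGraph_cons_add_le hβ y z a).trans ?_⟩
    -- `y` is absorbed by the longer tuple `z, a`, and then `z` by `a`.
    refine (hS _ _ fun i hi => ?_).trans
      (hS' _ _ fun i hi => ha i (Finset.mem_union_right _ hi))
    rw [Fin.range_cons]
    exact Set.mem_insert_of_mem _ (ha i (Finset.mem_union_left _ hi))
  | smul c z _ hz =>
    obtain ⟨S, hS⟩ := hz
    exact ⟨S, fun p a ha => (opGraph_cons_smul_le hβ c z a).trans (hS p a ha)⟩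

lemma exists_opGraph_le_basis (hβ : BetaRelations M A β) {ι : Type*} (e : Module.Basis ι F A)
    (a : Fin p → A) :
    ∃ S : Finset ι, ∀ (s : ℕ) (c : Fin s → ι), (S : Set ι) ⊆ Set.range c →
      opGraph β n a ≤ opGraph β n (fun i => e (c i)) := by
  classical
  choose S hS using fun z => exists_opGraph_cons_le (n := n) hβ e z
  -- Keeping `b` alongside `a` allows the entries of `a` to be removed one at a time, each absorbed
  -- by the basis vectors in `b`.
  suffices H : ∀ (p : ℕ) (a : Fin p → A), ∃ S : Finset ι, ∀ (s : ℕ) (b : Fin s → A),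
      (∀ i ∈ S, e i ∈ Set.range b) → opGraph β n (Fin.append a b) ≤ opGraph β n b by
    obtain ⟨S, hS⟩ := H p a
    refine ⟨S, fun s c hc => le_trans ?_ (hS s _ fun i hi => ?_)⟩
    · refine opGraph_le_of_range_subset hβ ?_
      rintro _ ⟨i, rfl⟩
      exact ⟨Fin.castAdd s i, Fin.append_left _ _ i⟩
    · obtain ⟨k, rfl⟩ := hc hi
      exact ⟨k, rfl⟩
  intro p
  induction p with
  | zero =>
    refine fun a => ⟨∅, fun s b _ => opGraph_le_of_range_subset hβ ?_⟩
    rintro _ ⟨i, rfl⟩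
    refine Fin.addCases (fun i => i.elim0) (fun i => ?_) i
    rw [Fin.append_right]
    exact Set.mem_range_self i
  | succ p ih =>
    intro a
    obtain ⟨S', hS'⟩ := ih (Fin.tail a)
    refine ⟨S (a 0) ∪ S', fun s b hb => ?_⟩
    refine le_trans ?_ (hS' s b fun i hi => hb i (Finset.mem_union_right _ hi))
    refine le_trans ?_ (hS (a 0) _ (Fin.append (Fin.tail a) b) fun i hi => ?_)
    · refine opGraph_le_of_range_subset hβ ?_
      rintro _ ⟨i, rfl⟩
      rw [Fin.range_cons]
      refine Fin.addCases (fun i => ?_) (fun i => ?_) i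
      · rw [Fin.append_left]
        refine Fin.cases (Set.mem_insert _ _) (fun i => ?_) i
        exact Set.mem_insert_of_mem _ ⟨Fin.castAdd s i, Fin.append_left _ _ i⟩
      · rw [Fin.append_right]
        exact Set.mem_insert_of_mem _ ⟨Fin.natAdd p i, Fin.append_right _ _ i⟩
    · obtain ⟨k, hk⟩ := hb i (Finset.mem_union_left _ hi)
      exact ⟨Fin.natAdd p k, by rw [Fin.append_right, hk]⟩

/-- The graph is that of a function. -/
lemma eq_zero_of_mem_opGraph (hβ : BetaRelations M A β) {a : Fin p → A} {y : A}
    (h : ((0 : Representation.invariants (diagRep M A n)), y) ∈ opGraph β n a) : y = 0 := by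
  let e := Module.Basis.ofVectorSpace F A
  obtain ⟨S, hS⟩ := exists_opGraph_le_basis (n := n) hβ e a
  let c : Fin S.card → _ := fun i => (S.equivFin.symm i).1
  have hc : Function.Injective c := Subtype.val_injective.comp S.equivFin.symm.injective
  -- Over the distinct basis vectors `e (c i)`, the first component 0 forces every `x r` to vanish,
  -- and then so does the second.
  obtain ⟨x, hx⟩ := exists_sum_of_mem_opGraph hβ
    (hS _ c (fun i hi => ⟨S.equivFin ⟨i, hi⟩, by simp [c]⟩) h)
  have h1 := congrArg Prod.fst hx
  have h2 := congrArg Prod.snd hx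
  rw [Prod.fst_sum] at h1
  rw [Prod.snd_sum] at h2
  have hx0 := eq_zero_of_sum_orbitElt_eq_zero e hc x h1.symm
  refine h2.trans (Finset.sum_eq_zero fun r _ => ?_)
  rw [hx0 r]
  exact hβ.op_zero r _

/-- Both pairs lie in the graph over `Fin.append a b`; their difference there has first component 0.
-/
lemma opGraph_unique (hβ : BetaRelations M A β) {a : Fin p → A} {b : Fin s → A}
    {t : Representation.invariants (diagRep M A n)} {y z : A} (hy : (t, y) ∈ opGraph β n a)
    (hz : (t, z) ∈ opGraph β n b) : y = z := by
  have ha := opGraph_comp_le (n := n) hβ (Fin.castAdd s) (Fin.append a b)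
  have hb := opGraph_comp_le (n := n) hβ (Fin.natAdd p) (Fin.append a b)
  simp only [Fin.append_left] at ha
  simp only [Fin.append_right] at hb
  have h := Submodule.sub_mem _ (ha hy) (hb hz)
  rw [Prod.mk_sub_mk, sub_self] at h
  exact sub_eq_zero.1 (eq_zero_of_mem_opGraph hβ h)

end Graph

/-! ### Generation of the invariants and the linear map attached to `β` -/

lemma exists_sum_orbitElt (t : Representation.invariants (diagRep M A n)) :
    ∃ (p : ℕ) (a : Fin p → A) (x : ∀ r : Comp p n, M.inv r),
      t = ∑ r, orbitElt r (x r) a := by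
  obtain ⟨p, c, x, h⟩ := exists_sum_orbitElt_basis (Module.Basis.ofVectorSpace F A) t
  exact ⟨p, _, x, h⟩

/-- Two linear maps on `(M(n) ⊗ A^{⊗ n})^{Σ_n}` that agree on the orbit elements are equal. -/
lemma linearMap_ext_orbitElt {V : Type*} [AddCommGroup V] [Module F V]
    {f g : Representation.invariants (diagRep M A n) →ₗ[F] V}
    (h : ∀ (p : ℕ) (r : Comp p n) (x : M.inv r) (a : Fin p → A),
      f (orbitElt r x a) = g (orbitElt r x a)) : f = g := by
  ext1 t
  obtain ⟨p, a, x, rfl⟩ := exists_sum_orbitElt t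
  rw [map_sum, map_sum]
  exact Finset.sum_congr rfl fun r _ => h p r (x r) a

/-- Operations satisfying the six relations come from a linear map on invariants. -/
lemma exists_linearMap_orbitElt {β : BetaOps M A} (hβ : BetaRelations M A β) (n : ℕ) :
    ∃ f : Representation.invariants (diagRep M A n) →ₗ[F] A,
      ∀ (p : ℕ) (r : Comp p n) (x : M.inv r) (a : Fin p → A), f (orbitElt r x a) = β r x a := by
  have hex : ∀ t : Representation.invariants (diagRep M A n),
      ∃ (y : A) (p : ℕ) (a : Fin p → A), (t, y) ∈ opGraph β n a := by
    intro t
    obtain ⟨p, a, x, rfl⟩ := exists_sum_orbitElt t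
    refine ⟨∑ r, β r (x r) a, p, a, ?_⟩
    rw [prod_mk_sum]
    exact Submodule.sum_mem _ fun r _ => mem_opGraph r (x r) a
  -- The tuple `a t` varies with `t`, but `opGraph_unique` makes the value independent of it; this
  -- yields linearity and the formula on orbit elements.
  choose f k a hf using hex
  refine ⟨⟨⟨f, fun t t' => ?_⟩, fun c t => ?_⟩, fun p r x b => ?_⟩
  · have h1 := opGraph_comp_le (n := n) hβ (Fin.castAdd (k t')) (Fin.append (a t) (a t'))
    have h2 := opGraph_comp_le (n := n) hβ (Fin.natAdd (k t)) (Fin.append (a t) (a t'))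
    simp only [Fin.append_left] at h1
    simp only [Fin.append_right] at h2
    exact opGraph_unique hβ (hf (t + t')) (Submodule.add_mem _ (h1 (hf t)) (h2 (hf t')))
  · exact opGraph_unique hβ (hf (c • t)) (Submodule.smul_mem _ c (hf t))
  · exact opGraph_unique hβ (hf (orbitElt r x b)) (mem_opGraph r x b)

/-! ### The inverse functor -/

/-- The structure map `Γ(M, A) → A` of an object of `β(M)`. -/
def BetaMod.str (X : BetaMod.{u, v, w} M) : Gamma M X.carrier →ₗ[F] X.carrier :=
  DirectSum.toModule F ℕ X.carrier fun n => (exists_linearMap_orbitElt X.rel n).choose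

lemma BetaMod.str_lof_orbitElt (X : BetaMod.{u, v, w} M) (r : Comp p n) (x : M.inv r)
    (a : Fin p → X.carrier) :
    X.str (DirectSum.lof F ℕ (fun n => Representation.invariants (diagRep M X.carrier n)) n
      (orbitElt r x a)) = X.op r x a := by
  rw [BetaMod.str, DirectSum.toModule_lof]
  exact (exists_linearMap_orbitElt X.rel n).choose_spec p r x a

/-- Linear maps on `Γ(M, A)` that agree on the orbit elements are equal. -/
lemma Gamma.linearMap_ext {V : Type*} [AddCommGroup V] [Module F V] {f g : Gamma M A →ₗ[F] V}
    (h : ∀ (p n : ℕ) (r : Comp p n) (x : M.inv r) (a : Fin p → A),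
      f (DirectSum.lof F ℕ (fun n => Representation.invariants (diagRep M A n)) n
        (orbitElt r x a)) =
      g (DirectSum.lof F ℕ (fun n => Representation.invariants (diagRep M A n)) n
        (orbitElt r x a))) : f = g :=
  DirectSum.linearMap_ext _ fun n => linearMap_ext_orbitElt fun p r x a => h p n r x a

lemma Gamma.map_lof_orbitElt {B : Type w} [AddCommGroup B] [Module F B] (g : A →ₗ[F] B)
    (r : Comp p n) (x : M.inv r) (a : Fin p → A) :
    Gamma.map M g (DirectSum.lof F ℕ (fun n => Representation.invariants (diagRep M A n)) n
      (orbitElt r x a)) =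
    DirectSum.lof F ℕ (fun n => Representation.invariants (diagRep M B n)) n
      (orbitElt r x fun i => g (a i)) := by
  rw [Gamma.map, DirectSum.lmap_lof]
  congr 1
  exact Subtype.ext (tensorMap_orbitElt g r x a)

/-- The inverse functor `β(M) → Γ(M)_mod`, the identity on underlying linear maps. -/
def functorG (M : SigmaModule.{u, v} F) : BetaMod.{u, v, w} M ⥤ GammaMod.{u, v, w} M where
  obj X := ⟨X.carrier, X.str⟩
  map {X Y} g := ⟨g.lin, Gamma.linearMap_ext fun p n r x a => by
    rw [LinearMap.comp_apply, LinearMap.comp_apply, Gamma.map_lof_orbitElt,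
      X.str_lof_orbitElt, Y.str_lof_orbitElt, g.comm]⟩

/-! ### The two composites are identities -/

/-- The round trip returns structure maps that are equal but not definitionally so. Morphisms before
and after thus have different types, and equality of functors requires a heterogeneous comparison.
-/
lemma GammaMod.Hom.heq {A B : Type w} [AddCommGroup A] [Module F A] [AddCommGroup B] [Module F B]
    {f f' : Gamma M A →ₗ[F] A} {g g' : Gamma M B →ₗ[F] B} (hf : f = f') (hg : g = g')
    (k : GammaMod.Hom ⟨A, f⟩ ⟨B, g⟩) (k' : GammaMod.Hom ⟨A, f'⟩ ⟨B, g'⟩)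
    (h : k.lin = k'.lin) : HEq k k' := by
  subst hf hg
  exact heq_of_eq (GammaMod.Hom.ext h)

lemma BetaMod.Hom.heq {A B : Type w} [AddCommGroup A] [Module F A] [AddCommGroup B] [Module F B]
    {β β' : BetaOps M A} {γ γ' : BetaOps M B} (hβ : @β = @β') (hγ : @γ = @γ')
    {rβ : BetaRelations M A β} {rβ' : BetaRelations M A β'}
    {rγ : BetaRelations M B γ} {rγ' : BetaRelations M B γ'}
    (k : BetaMod.Hom ⟨A, β, rβ⟩ ⟨B, γ, rγ⟩) (k' : BetaMod.Hom ⟨A, β', rβ'⟩ ⟨B, γ', rγ'⟩)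
    (h : k.lin = k'.lin) : HEq k k' := by
  subst hβ hγ
  exact heq_of_eq (BetaMod.Hom.ext h)

/-- The operations of `functorF` are the values of `X.str` on orbit elements, and these values
determine a linear map. -/
lemma str_functorF_obj (X : GammaMod.{u, v, w} M) : ((functorF M).obj X).str = X.str :=
  Gamma.linearMap_ext fun _ _ r x a => ((functorF M).obj X).str_lof_orbitElt r x a

lemma op_functorG_obj (X : BetaMod.{u, v, w} M) :
    @GammaMod.op _ _ _ ((functorG M).obj X) = @X.op := by
  funext p n r x a
  exact X.str_lof_orbitElt r x a

lemma functorF_comp_functorG (M : SigmaModule.{u, v} F) :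
    functorF M ⋙ functorG M = 𝟭 (GammaMod.{u, v, w} M) := by
  refine Functor.hext (fun X => ?_) fun X Y g => ?_
  · exact congrArg (GammaMod.mk X.carrier) (str_functorF_obj X)
  · exact GammaMod.Hom.heq (str_functorF_obj X) (str_functorF_obj Y) _ _ rfl

lemma functorG_comp_functorF (M : SigmaModule.{u, v} F) :
    functorG M ⋙ functorF M = 𝟭 (BetaMod.{u, v, w} M) := by
  refine Functor.hext (fun X => ?_) fun X Y g => ?_
  · obtain ⟨A, β, hβ⟩ := X
    have h := op_functorG_obj ⟨A, β, hβ⟩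
    dsimp [functorF]
    congr 1
  · exact BetaMod.Hom.heq (op_functorG_obj X) (op_functorG_obj Y) _ _ rfl

end

end DividedPower

theorem mainTheorem4 {F : Type u} [Field F] (M : DividedPower.SigmaModule.{u, v} F) :
    ∃ G : DividedPower.BetaMod.{u, v, w} M ⥤ DividedPower.GammaMod.{u, v, w} M,
      DividedPower.functorF M ⋙ G = 𝟭 (DividedPower.GammaMod.{u, v, w} M) ∧
        G ⋙ DividedPower.functorF M = 𝟭 (DividedPower.BetaMod.{u, v, w} M) := by
  exact ⟨DividedPower.functorG M, DividedPower.functorF_comp_functorG M,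
    DividedPower.functorG_comp_functorF M⟩
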